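/- Let $n\ge 1$, let $\mathbb P=\mathbb P(\mathbb C^{n+1})$ be complex projective space and $\mathbb P'=\mathbb P((\mathbb C^{n+1})^\vee)$ its dual. Let $\Omega\subset\mathbb P$ be non-empty and open and let $\Lambda\subset\mathbb P'$ be non-empty and closed (hence compact), such that $\boldsymbol\phi(\boldsymbol\omega)\neq 0$ for all $\phi\in\Lambda$, $\omega\in\Omega$, where bold letters denote arbitrary lifts; such a pair is called admissible. Suppose that $\Omega$ is saturated, i.e. $\Omega$ is the set of all points of $\mathbb P$ at which no form of $\Lambda$ vanishes. For $\omega,\omega'\in\Omega$ put $$d_\Lambda(\omega,\omega')=\ln\max_{\phi,\phi'\in\Lambda}\bigl|[\phi,\phi',\omega,\omega']\bigr|,\qquad [\phi,\phi',\omega,\omega']=\frac{\boldsymbol\phi(\boldsymbol\omega)\,\boldsymbol\phi'(\boldsymbol\omega')}{\boldsymbol\phi(\boldsymbol\omega')\,\boldsymbol\phi'(\boldsymbol\omega)}.$$ When $\omega\ne\omega'$ and $\ker\boldsymbol\phi$, $\ker\boldsymbol\phi'$ meet the line $(\omega\omega')$ at distinct points $a,b$, the number $[\phi,\phi',\omega,\omega']$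 is the cross-ratio of the four points $a,b,\omega,\omega'$ of that line, i.e. the coordinate of $\omega'$ when $a,b,\omega$ are placed at $\infty,0,1$. Then: (1) $\Omega$ is pseudo-convex, i.e. there is a continuous plurisubharmonic exhaustion function on $\Omega$. (2) For each $\omega_0\in\Omega$, the function $F\colon\omega\mapsto d_\Lambda(\omega_0,\omega)$ is plurisubharmonic on $\Omega$ (hence subharmonic in each affine chart). (3) If moreover the hyperplanes in $\Lambda$ have no point of $\mathbb P$ in common (i.e. the lifts of the elements of $\Lambda$ span $(\mathbb C^{n+1})^\vee$), then for each $\omega_0\in\Omega$ the function $F$ is an exhaustion function of $\Omega$: it is continuous and for every $c\in\mathbb R$ the set $\{\omega\in\Omega : F(\omega)<c\}$ is relatively compact in $\Omega$. -/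

import Mathlib

namespace ComplexHilbert

/-- The quotient topology on a projective space `P(V)`. -/
instance projTopology {K V : Type*} [DivisionRing K] [AddCommGroup V] [Module K V]
    [TopologicalSpace V] : TopologicalSpace (Projectivization K V) :=
  TopologicalSpace.coinduced (fun v : {v : V // v ≠ 0} => Projectivization.mk K v.1 v.2)
    inferInstance

/-- The complex projective space `P(ℂ^{n+1})`. -/
abbrev CP (n : ℕ) : Type := Projectivization ℂ (Fin (n + 1) → ℂ)

/-- The dual projective space `P((ℂ^{n+1})^∨)`; every linear form on `ℂ^{n+1}` is continuous. -/
abbrev CPDual (n : ℕ) : Type := Projectivization ℂ ((Fin (n + 1) → ℂ) →L[ℂ] ℂ)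

/-- The (projective class of a) form `φ` vanishes at the point `ω`, i.e. `ω` lies on the
hyperplane defined by `φ`. -/
def Vanishes {n : ℕ} (φ : CPDual n) (ω : CP n) : Prop := φ.rep ω.rep = 0

/-- Vanishing can be tested on arbitrary lifts. -/
theorem vanishes_mk {n : ℕ} (f : (Fin (n + 1) → ℂ) →L[ℂ] ℂ) (hf : f ≠ 0)
    (v : Fin (n + 1) → ℂ) (hv : v ≠ 0) :
    Vanishes (Projectivization.mk ℂ f hf) (Projectivization.mk ℂ v hv) ↔ f v = 0 := by
  obtain ⟨a, ha⟩ := Projectivization.exists_smul_eq_mk_rep ℂ f hf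
  obtain ⟨b, hb⟩ := Projectivization.exists_smul_eq_mk_rep ℂ v hv
  unfold Vanishes
  rw [← ha, ← hb]
  simp [Units.smul_def]

/-- An admissible pair: non-empty sets `Ω ⊆ P`, `Λ ⊆ P'` with `Ω` open, `Λ` closed, such that
no form of `Λ` vanishes at a point of `Ω`. -/
structure IsAdmissible {n : ℕ} (Ω : Set (CP n)) (Λ : Set (CPDual n)) : Prop where
  nonempty_left : Ω.Nonempty
  nonempty_right : Λ.Nonempty
  isOpen : IsOpen Ω
  isClosed : IsClosed Λ
  not_vanishes : ∀ ω ∈ Ω, ∀ φ ∈ Λ, ¬ Vanishes φ ω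

/-- `Ω` is saturated: it is the set of all points at which no form of `Λ` vanishes. -/
def IsSaturated {n : ℕ} (Ω : Set (CP n)) (Λ : Set (CPDual n)) : Prop :=
  Ω = {ω | ∀ φ ∈ Λ, ¬ Vanishes φ ω}

/-- The cross-ratio `[φ, φ', ω, ω'] = φ(ω) φ'(ω') / (φ(ω') φ'(ω))`, computed on lifts. -/
noncomputable def crossRatio {n : ℕ} (φ φ' : CPDual n) (ω ω' : CP n) : ℂ :=
  (φ.rep ω.rep * φ'.rep ω'.rep) / (φ.rep ω'.rep * φ'.rep ω.rep)

/-- The cross-ratio can be computed on arbitrary lifts. -/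
theorem crossRatio_mk {n : ℕ} (f f' : (Fin (n + 1) → ℂ) →L[ℂ] ℂ) (hf : f ≠ 0) (hf' : f' ≠ 0)
    (v v' : Fin (n + 1) → ℂ) (hv : v ≠ 0) (hv' : v' ≠ 0) :
    crossRatio (Projectivization.mk ℂ f hf) (Projectivization.mk ℂ f' hf')
      (Projectivization.mk ℂ v hv) (Projectivization.mk ℂ v' hv') =
      (f v * f' v') / (f v' * f' v) := by
  obtain ⟨a, ha⟩ := Projectivization.exists_smul_eq_mk_rep ℂ f hf
  obtain ⟨a', ha'⟩ := Projectivization.exists_smul_eq_mk_rep ℂ f' hf'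
  obtain ⟨b, hb⟩ := Projectivization.exists_smul_eq_mk_rep ℂ v hv
  obtain ⟨b', hb'⟩ := Projectivization.exists_smul_eq_mk_rep ℂ v' hv'
  unfold crossRatio
  rw [← ha, ← ha', ← hb, ← hb']
  simp only [Units.smul_def, map_smul, FunLike.coe_smul, Pi.smul_apply, smul_eq_mul]
  have h : (a : ℂ) * a' * b * b' ≠ 0 := by simp
  rw [← mul_div_mul_left (f v * f' v') (f v' * f' v) h]
  congr 1 <;> ring

/-- `t` is the cross-ratio of four collinear points `a, b, c, d` (with `a, b, c` distinct): in a
suitable projective coordinate of their common line they are `∞, 0, 1, t`. -/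
def IsCrossRatio {n : ℕ} (a b c d : CP n) (t : ℂ) : Prop :=
  ∃ e f : Fin (n + 1) → ℂ, LinearIndependent ℂ ![e, f] ∧
    a.submodule = Submodule.span ℂ {e} ∧ b.submodule = Submodule.span ℂ {f} ∧
    c.submodule = Submodule.span ℂ {e + f} ∧ d.submodule = Submodule.span ℂ {t • e + f}

/-- `crossRatio φ φ' ω ω'` is the cross-ratio of `ker φ ∩ (ωω'), ker φ' ∩ (ωω'), ω, ω'` on the
line `(ωω')`. -/
theorem isCrossRatio_iff {n : ℕ} (φ φ' : CPDual n) (ω ω' a b : CP n) (hω : ω ≠ ω')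
    (h1 : ¬ Vanishes φ ω) (h2 : ¬ Vanishes φ ω') (h3 : ¬ Vanishes φ' ω) (h4 : ¬ Vanishes φ' ω')
    (ha : a.submodule ≤ ω.submodule ⊔ ω'.submodule) (hφa : Vanishes φ a)
    (hb : b.submodule ≤ ω.submodule ⊔ ω'.submodule) (hφb : Vanishes φ' b)
    (hab : a ≠ b) (t : ℂ) :
    IsCrossRatio a b ω ω' t ↔ t = crossRatio φ φ' ω ω' := by
  have hs : ∀ (x y : Fin (n + 1) → ℂ) (c d : ℂ), c ≠ 0 → d ≠ 0 → c • x = d • y →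
      Submodule.span ℂ {x} = Submodule.span ℂ {y} := by
    intro x y c d hc hd h
    rw [← Submodule.span_singleton_smul_eq (IsUnit.mk0 c hc) x, h,
      Submodule.span_singleton_smul_eq (IsUnit.mk0 d hd) y]
  have hvw : LinearIndependent ℂ ![ω.rep, ω'.rep] := by
    have h := Projectivization.linearIndependent_pair_iff_ne.2 hω
    convert h using 1
  have hline : ∀ (ψ : CPDual n) (p : CP n), ¬ Vanishes ψ ω → ¬ Vanishes ψ ω' →
      p.submodule ≤ ω.submodule ⊔ ω'.submodule → Vanishes ψ p →
      p.submodule = Submodule.span ℂ {ψ.rep ω'.rep • ω.rep - ψ.rep ω.rep • ω'.rep} := by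
    intro ψ p k1 k2 hp hz
    rw [Projectivization.submodule_eq p] at hp ⊢
    have hmem := hp (Submodule.mem_span_singleton_self _)
    rw [Projectivization.submodule_eq ω, Projectivization.submodule_eq ω',
      Submodule.mem_sup] at hmem
    obtain ⟨y, hy, z, hz', hyz⟩ := hmem
    obtain ⟨r, rfl⟩ := Submodule.mem_span_singleton.1 hy
    obtain ⟨q, rfl⟩ := Submodule.mem_span_singleton.1 hz'
    have h0 := hz
    unfold Vanishes at h0 k1 k2
    rw [← hyz, map_add, map_smul, map_smul, smul_eq_mul, smul_eq_mul] at h0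
    have hr : r ≠ 0 := by
      rintro rfl
      have hq : q = 0 := by
        simpa [k2] using h0
      apply Projectivization.rep_nonzero p
      rw [← hyz, hq]
      simp
    refine hs _ _ (ψ.rep ω'.rep) r k2 hr ?_
    rw [← hyz]
    have : ψ.rep ω'.rep * q = - (r * ψ.rep ω.rep) := by linear_combination h0
    rw [smul_add, smul_sub, smul_smul, smul_smul, smul_smul, smul_smul, this, mul_comm r (ψ.rep ω.rep)]
    rw [neg_smul, sub_eq_add_neg, mul_comm r (ψ.rep ω'.rep)]
  have hA := hline φ a h1 h2 ha hφa
  have hB := hline φ' b h3 h4 hb hφb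
  unfold Vanishes at h1 h2 h3 h4
  unfold IsCrossRatio crossRatio
  rw [hA, hB, Projectivization.submodule_eq ω, Projectivization.submodule_eq ω']
  have hD : φ.rep ω'.rep * φ'.rep ω.rep - φ.rep ω.rep * φ'.rep ω'.rep ≠ 0 := by
    intro h
    apply hab
    apply Projectivization.submodule_injective
    rw [hA, hB]
    refine hs _ _ (φ'.rep ω.rep) (φ.rep ω.rep) h3 h1 ?_
    rw [smul_sub, smul_sub, smul_smul, smul_smul, smul_smul, smul_smul]
    congr 2
    · linear_combination h
    · ring
  generalize ω.rep = v at *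
  generalize ω'.rep = w at *
  generalize φ.rep = f at *
  generalize φ'.rep = g at *
  rw [LinearIndependent.pair_iff] at hvw
  constructor
  · rintro ⟨e, k, -, ka, kb, kc, kd⟩
    obtain ⟨α, rfl⟩ := Submodule.span_singleton_eq_span_singleton.1 ka
    obtain ⟨β, rfl⟩ := Submodule.span_singleton_eq_span_singleton.1 kb
    obtain ⟨γ, hγ⟩ := Submodule.span_singleton_eq_span_singleton.1 kc
    obtain ⟨δ, hδ⟩ := Submodule.span_singleton_eq_span_singleton.1 kd
    simp only [Units.smul_def] at hγ hδ
    have e1 := (hvw (α * f w + β * g w - γ) (-(α * f v + β * g v)) (by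
      rw [← sub_eq_zero] at hγ
      rw [← neg_eq_zero, ← hγ]
      module)).2
    have e2 := (hvw (t * α * f w + β * g w) (-(t * α * f v + β * g v) - δ) (by
      rw [← sub_eq_zero] at hδ
      rw [← neg_eq_zero, ← hδ]
      module)).1
    rw [eq_div_iff (mul_ne_zero h2 h3)]
    have hα : (α : ℂ) ≠ 0 := α.ne_zero
    apply mul_left_cancel₀ hα
    linear_combination g v * e2 + g w * e1
  · intro ht
    rw [eq_div_iff (mul_ne_zero h2 h3)] at ht
    refine ⟨g v • (f w • v - f v • w), -(f v) • (g w • v - g v • w), ?_, ?_, ?_, ?_, ?_⟩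
    · rw [LinearIndependent.pair_iff]
      intro x y hxy
      obtain ⟨k1, k2⟩ := hvw (x * g v * f w - y * f v * g w) (-(x * g v * f v) + y * f v * g v) (by
        rw [← hxy]
        module)
      have hx : x = y := by
        apply mul_right_cancel₀ (mul_ne_zero h1 h3)
        linear_combination -k2
      subst hx
      have : x = 0 := by
        apply (mul_eq_zero.1 (show x * (f w * g v - f v * g w) = 0 by
          linear_combination k1)).resolve_right hD
      exact ⟨this, this⟩
    · exact hs _ _ (g v) 1 h3 one_ne_zero (by simp)
    · exact hs _ _ (-(f v)) 1 (neg_ne_zero.2 h1) one_ne_zero (by simp)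
    · refine hs _ _ (f w * g v - f v * g w) 1 hD one_ne_zero ?_
      module
    · have ht1 : t - 1 ≠ 0 := by
        intro h
        apply hD
        have : t = 1 := by linear_combination h
        rw [this] at ht
        linear_combination ht
      refine hs _ _ (-(f v * g v * (t - 1))) 1
        (neg_ne_zero.2 (mul_ne_zero (mul_ne_zero h1 h3) ht1)) one_ne_zero ?_
      have : (t * g v * f w - f v * g w) • v = 0 := by
        rw [show t * g v * f w - f v * g w = 0 by linear_combination ht, zero_smul]
      rw [← sub_eq_zero, ← neg_eq_zero, ← this]
      module

/-- The generalized Hilbert pseudo-metric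
`d_Λ(ω, ω') = ln max {|[φ, φ', ω, ω']| : φ, φ' ∈ Λ}`. -/
noncomputable def hilbertDist {n : ℕ} (Λ : Set (CPDual n)) (ω ω' : CP n) : ℝ :=
  Real.log (sSup {r : ℝ | ∃ φ ∈ Λ, ∃ φ' ∈ Λ, r = ‖crossRatio φ φ' ω ω'‖})

/-- A real-valued function on a subset `U` of a complex vector space is plurisubharmonic if it is
upper semicontinuous and satisfies the sub-mean value inequality on every closed complex disc
contained in `U`. (Integrability on the boundary circle is automatic for a real-valued
plurisubharmonic function; it is listed so that the mean value is a genuine one.) -/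
def IsPlurisubharmonicOn {E : Type*} [AddCommGroup E] [Module ℂ E] [TopologicalSpace E]
    (u : E → ℝ) (U : Set E) : Prop :=
  UpperSemicontinuousOn u U ∧
    ∀ a b : E, (∀ ζ : ℂ, ‖ζ‖ ≤ 1 → a + ζ • b ∈ U) →
      CircleIntegrable (fun ζ : ℂ => u (a + ζ • b)) 0 1 ∧
        u a ≤ Real.circleAverage (fun ζ : ℂ => u (a + ζ • b)) 0 1

/-- The `i`-th standard affine chart `ℂⁿ → P`,
`z ↦ [z₀ : … : z_{i-1} : 1 : z_i : … : z_{n-1}]`. -/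
noncomputable def affineChart {n : ℕ} (i : Fin (n + 1)) (z : Fin n → ℂ) : CP n :=
  Projectivization.mk ℂ (i.insertNth (1 : ℂ) z : Fin (n + 1) → ℂ) (fun h => by
    have := congrFun h i
    simp at this)

/-- A real-valued function on a subset of projective space is plurisubharmonic if it is so in each
standard affine chart. -/
def IsPSHOn {n : ℕ} (u : CP n → ℝ) (Ω : Set (CP n)) : Prop :=
  ∀ i : Fin (n + 1),
    IsPlurisubharmonicOn (fun z => u (affineChart i z)) {z | affineChart i z ∈ Ω}

/-- `u` is an exhaustion function of `Ω`: it is continuous and each sublevel set `{u < c}` is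
relatively compact in `Ω`. -/
def IsExhaustionOn {X : Type*} [TopologicalSpace X] (u : X → ℝ) (Ω : Set X) : Prop :=
  ContinuousOn u Ω ∧ ∀ c : ℝ, ∃ K : Set X, IsCompact K ∧ K ⊆ Ω ∧ {x ∈ Ω | u x < c} ⊆ K

/-- An open subset of projective space is pseudo-convex if it carries a continuous plurisubharmonic
exhaustion function. -/
def IsPseudoconvex {n : ℕ} (Ω : Set (CP n)) : Prop :=
  IsOpen Ω ∧ ∃ u : CP n → ℝ, IsPSHOn u Ω ∧ IsExhaustionOn u Ω

end ComplexHilbert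

namespace ComplexHilbert

open Set Metric Topology

/-! ### Compactness of projective space and of families of forms. -/

section Projective

/-! All three claims concern one kind of function, `logRatio Φ Ψ`: the logarithm of the supremum of
`|ψ| / |φ|` over compact sets `Φ`, `Ψ` of linear forms. The quotient is homogeneous of degree 0, so
it lives on projective space. Plurisubharmonicity (`isPSHOn_logRatio`): where no `φ` vanishes, each
`log |ψ| - log |φ|` is subharmonic on complex discs, because `log |φ|` is harmonic there. The
supremum over a compact family is continuous and attained, so it inherits the sub-mean value
inequality. Exhaustion (`isExhaustionOn_logRatio`): if the forms in `Ψ` have no common zero, the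
quotient blows up wherever some `φ` vanishes, that is, at the boundary of the saturated set `Ω`. For
pseudo-convexity, `Φ` consists of the unit lifts of `Λ` and `Ψ` of the coordinate forms. For
`d_Λ(ω₀, ·)`, both are the lifts of `Λ` normalized to be 1 at `ω₀`, which turns the cross-ratio into
`φ'(ω) / φ(ω)`. -/

theorem isQuotientMap_mk {V : Type*} [NormedAddCommGroup V] [NormedSpace ℂ V] :
    IsQuotientMap (fun v : {v : V // v ≠ 0} => Projectivization.mk ℂ v.1 v.2) := by
  refine ⟨⟨rfl⟩, fun p => ⟨⟨p.rep, p.rep_nonzero⟩, p.mk_rep⟩⟩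

theorem continuous_sphere_mk {V : Type*} [NormedAddCommGroup V] :
    Continuous (fun v : sphere (0 : V) 1 =>
      (⟨v.1, ne_zero_of_mem_unit_sphere v⟩ : {v : V // v ≠ 0})) :=
  Continuous.subtype_mk continuous_subtype_val _

variable {V : Type*} [NormedAddCommGroup V] [NormedSpace ℂ V]

/-- The unit vectors representing a point of `Λ`. -/
def unitLifts (Λ : Set (Projectivization ℂ V)) : Set V :=
  {f | ‖f‖ = 1 ∧ ∃ h : f ≠ 0, Projectivization.mk ℂ f h ∈ Λ}

theorem exists_unitLift (p : Projectivization ℂ V) :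
    ∃ f : V, ‖f‖ = 1 ∧ ∃ h : f ≠ 0, Projectivization.mk ℂ f h = p := by
  have hp : ‖p.rep‖ ≠ 0 := norm_ne_zero_iff.2 p.rep_nonzero
  have hc : ((‖p.rep‖⁻¹ : ℝ) : ℂ) ≠ 0 := by exact_mod_cast inv_ne_zero hp
  refine ⟨((‖p.rep‖⁻¹ : ℝ) : ℂ) • p.rep, ?_, smul_ne_zero hc p.rep_nonzero, ?_⟩
  · rw [norm_smul]
    simp [hp]
  · conv_rhs => rw [← p.mk_rep]
    rw [Projectivization.mk_eq_mk_iff']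
    exact ⟨_, rfl⟩

variable [FiniteDimensional ℂ V]

theorem isCompact_unitLifts {Λ : Set (Projectivization ℂ V)} (hΛ : IsClosed Λ) :
    IsCompact (unitLifts Λ) := by
  have := FiniteDimensional.proper ℂ V
  have hc : IsClosed ((fun v : sphere (0 : V) 1 =>
      Projectivization.mk ℂ v.1 (ne_zero_of_mem_unit_sphere v)) ⁻¹' Λ) :=
    hΛ.preimage (isQuotientMap_mk.continuous.comp continuous_sphere_mk)
  convert hc.isCompact.image continuous_subtype_val using 1
  ext f
  constructor
  · rintro ⟨h1, h2, h3⟩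
    exact ⟨⟨f, by simpa using h1⟩, h3, rfl⟩
  · rintro ⟨⟨f, hf⟩, h, rfl⟩
    exact ⟨by simpa using hf, _, h⟩

theorem compactSpace_projectivization : CompactSpace (Projectivization ℂ V) := by
  have := FiniteDimensional.proper ℂ V
  refine ⟨?_⟩
  convert isCompact_range (isQuotientMap_mk.continuous.comp (continuous_sphere_mk (V := V)))
  refine (eq_univ_of_forall fun p => ?_).symm
  obtain ⟨f, h1, h2, h3⟩ := exists_unitLift p
  exact ⟨⟨f, by simpa using h1⟩, h3⟩

end Projective

/-! ### Circle averages of logarithms of affine functions. -/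

section SubMeanValue

/-- The sub-mean value inequality for the logarithm of an affine function; the comparison
function `g` is only constrained away from the zero of the affine function. -/
theorem log_norm_le_circleAverage {α β : ℂ} (hα : α ≠ 0) {g : ℂ → ℝ}
    (hg : CircleIntegrable g 0 1)
    (h : ∀ ζ ∈ sphere (0 : ℂ) 1, α + ζ * β ≠ 0 → Real.log ‖α + ζ * β‖ ≤ g ζ) :
    Real.log ‖α‖ ≤ Real.circleAverage g 0 1 := by
  classical
  rcases eq_or_ne β 0 with rfl | hβ
  · rw [← Real.circleAverage_const (Real.log ‖α‖) 0 1]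
    refine Real.circleAverage_mono (circleIntegrable_const _ _ _) hg fun ζ hζ => ?_
    simpa using h ζ (by simpa using hζ) (by simpa using hα)
  · have key : ∀ ζ, ζ ≠ -(α / β) →
        Real.log ‖β‖ + Real.log ‖ζ + α / β‖ = Real.log ‖α + ζ * β‖ := by
      intro ζ hζ
      have h1 : ζ + α / β ≠ 0 := fun h0 => hζ (eq_neg_of_add_eq_zero_left h0)
      rw [← Real.log_mul (norm_ne_zero_iff.2 hβ) (norm_ne_zero_iff.2 h1), ← norm_mul]
      congr 2
      field_simp
      ring
    have hint : CircleIntegrable (fun ζ : ℂ => Real.log ‖ζ + α / β‖) 0 1 := by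
      simpa using circleIntegrable_log_norm_sub_const (a := -(α / β)) (c := 0) 1
    have hint' : CircleIntegrable (fun ζ : ℂ => Real.log ‖β‖ + Real.log ‖ζ + α / β‖) 0 1 :=
      (circleIntegrable_const _ _ _).add hint
    -- Jensen's formula: `log |ζ + c|` has average `log⁺ |c|` on the unit circle, which is at least
    -- its value `log |c|` at the centre.
    have hav : Real.circleAverage (fun ζ : ℂ => Real.log ‖β‖ + Real.log ‖ζ + α / β‖) 0 1 =
        Real.log ‖β‖ + Real.posLog ‖α / β‖ := by
      have := Real.circleAverage_add (circleIntegrable_const (Real.log ‖β‖) 0 1) hint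
      rw [Real.circleAverage_const, circleAverage_log_norm_add_const_eq_posLog] at this
      exact this
    -- Since `Real.log 0 = 0`, the logarithmic term equals `log ‖β‖` at the zero `-(α / β)` and may
    -- exceed `g` there. Raising `g` at this single point repairs the comparison without changing
    -- its average.
    have hev : g =ᶠ[Filter.codiscreteWithin (sphere (0 : ℂ) |1|)]
        fun ζ => if ζ = -(α / β) then
          max (g ζ) (Real.log ‖β‖ + Real.log ‖ζ + α / β‖) else g ζ := by
      have : ({-(α / β)}ᶜ : Set ℂ) ∈ Filter.codiscreteWithin (sphere (0 : ℂ) |1|) :=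
        Filter.codiscreteWithin_mono (subset_univ _) (by
          simp)
      filter_upwards [this] with ζ hζ
      rw [if_neg (by simpa using hζ)]
    calc Real.log ‖α‖ = Real.log ‖β‖ + Real.log ‖α / β‖ := by
          rw [norm_div, Real.log_div (norm_ne_zero_iff.2 hα) (norm_ne_zero_iff.2 hβ)]
          ring
      _ ≤ Real.log ‖β‖ + Real.posLog ‖α / β‖ := by
          gcongr
          exact le_max_right _ _
      _ ≤ _ := by
          rw [← hav, Real.circleAverage_congr_codiscreteWithin hev one_ne_zero]
          refine Real.circleAverage_mono hint' (hg.congr_codiscreteWithin hev) fun ζ hζ => ?_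
          split_ifs with hz
          · exact le_max_right _ _
          · rw [key ζ hz]
            refine h ζ (by simpa using hζ) fun h0 => hz ?_
            field_simp
            linear_combination h0

/-- The mean value property for the logarithm of an affine function without zeros. -/
theorem circleAverage_log_norm_affine {α β : ℂ}
    (h : ∀ ζ : ℂ, ‖ζ‖ ≤ 1 → α + ζ * β ≠ 0) :
    CircleIntegrable (fun ζ : ℂ => Real.log ‖α + ζ * β‖) 0 1 ∧
      Real.circleAverage (fun ζ : ℂ => Real.log ‖α + ζ * β‖) 0 1 = Real.log ‖α‖ := by
  have han : AnalyticOnNhd ℂ (fun ζ : ℂ => α + ζ * β) (closedBall 0 |1|) :=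
    fun ζ _ => by fun_prop
  refine ⟨MeromorphicOn.circleIntegrable_log_norm
    fun ζ hζ => (han ζ (sphere_subset_closedBall hζ)).meromorphicAt, ?_⟩
  simpa using AnalyticOnNhd.circleAverage_log_norm_of_ne_zero han
    fun ζ hζ => h ζ (by simpa using hζ)

end SubMeanValue

/-! ### Suprema of quotients of linear forms. -/

section RatioSup

variable {n : ℕ}

/-- The supremum of `|ψ(v)| / |φ(v)|` over `φ ∈ Φ`, `ψ ∈ Ψ`. -/
noncomputable def ratioSup (Φ Ψ : Set ((Fin (n + 1) → ℂ) →L[ℂ] ℂ)) (v : Fin (n + 1) → ℂ) : ℝ :=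
  sSup ((fun p : ((Fin (n + 1) → ℂ) →L[ℂ] ℂ) × ((Fin (n + 1) → ℂ) →L[ℂ] ℂ) =>
    ‖p.2 v‖ / ‖p.1 v‖) '' Φ ×ˢ Ψ)

/-- The function `ω ↦ log sup {|ψ(ω)| / |φ(ω)| : φ ∈ Φ, ψ ∈ Ψ}` on projective space. -/
noncomputable def logRatio (Φ Ψ : Set ((Fin (n + 1) → ℂ) →L[ℂ] ℂ)) (ω : CP n) : ℝ :=
  Real.log (ratioSup Φ Ψ ω.rep)

variable {Φ Ψ : Set ((Fin (n + 1) → ℂ) →L[ℂ] ℂ)} {Ω : Set (CP n)}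

theorem logRatio_mk {v : Fin (n + 1) → ℂ} (hv : v ≠ 0) :
    logRatio Φ Ψ (Projectivization.mk ℂ v hv) = Real.log (ratioSup Φ Ψ v) := by
  obtain ⟨a, ha⟩ := Projectivization.exists_smul_eq_mk_rep ℂ v hv
  have h0 : ‖(a : ℂ)‖ ≠ 0 := norm_ne_zero_iff.2 a.ne_zero
  unfold logRatio ratioSup
  rw [← ha]
  simp only [Units.smul_def, map_smul, smul_eq_mul, norm_mul, mul_div_mul_left _ _ h0]

theorem apply_rep_mk_eq_zero (f : (Fin (n + 1) → ℂ) →L[ℂ] ℂ) {v : Fin (n + 1) → ℂ}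
    (hv : v ≠ 0) : f (Projectivization.mk ℂ v hv).rep = 0 ↔ f v = 0 := by
  obtain ⟨a, ha⟩ := Projectivization.exists_smul_eq_mk_rep ℂ v hv
  rw [← ha]
  simp [Units.smul_def]

theorem isCompact_ratio_image (hΦ : IsCompact Φ) (hΨ : IsCompact Ψ) {v : Fin (n + 1) → ℂ}
    (hv : ∀ φ ∈ Φ, φ v ≠ 0) :
    IsCompact ((fun p : ((Fin (n + 1) → ℂ) →L[ℂ] ℂ) × ((Fin (n + 1) → ℂ) →L[ℂ] ℂ) =>
      ‖p.2 v‖ / ‖p.1 v‖) '' Φ ×ˢ Ψ) := by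
  refine (hΦ.prod hΨ).image_of_continuousOn (ContinuousOn.div (by fun_prop) (by fun_prop) ?_)
  exact fun p hp => norm_ne_zero_iff.2 (hv p.1 hp.1)

theorem ratio_le_ratioSup (hΦ : IsCompact Φ) (hΨ : IsCompact Ψ) {v : Fin (n + 1) → ℂ}
    (hv : ∀ φ ∈ Φ, φ v ≠ 0) {φ ψ : (Fin (n + 1) → ℂ) →L[ℂ] ℂ} (hφ : φ ∈ Φ) (hψ : ψ ∈ Ψ) :
    ‖ψ v‖ / ‖φ v‖ ≤ ratioSup Φ Ψ v :=
  le_csSup (isCompact_ratio_image hΦ hΨ hv).bddAbove ⟨(φ, ψ), ⟨hφ, hψ⟩, rfl⟩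

theorem exists_ratio_eq_ratioSup (hΦ : IsCompact Φ) (hΨ : IsCompact Ψ) (hΦn : Φ.Nonempty)
    (hΨn : Ψ.Nonempty) {v : Fin (n + 1) → ℂ} (hv : ∀ φ ∈ Φ, φ v ≠ 0) :
    ∃ φ ∈ Φ, ∃ ψ ∈ Ψ, ‖ψ v‖ / ‖φ v‖ = ratioSup Φ Ψ v := by
  obtain ⟨p, hp, h⟩ := (isCompact_ratio_image hΦ hΨ hv).sSup_mem ((hΦn.prod hΨn).image _)
  exact ⟨p.1, hp.1, p.2, hp.2, h⟩

theorem ratioSup_pos (hΦ : IsCompact Φ) (hΨ : IsCompact Ψ) (hΦn : Φ.Nonempty)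
    {v : Fin (n + 1) → ℂ} (hv : ∀ φ ∈ Φ, φ v ≠ 0) (hv' : ∃ ψ ∈ Ψ, ψ v ≠ 0) :
    0 < ratioSup Φ Ψ v := by
  obtain ⟨φ, hφ⟩ := hΦn
  obtain ⟨ψ, hψ, h⟩ := hv'
  exact (div_pos (norm_pos_iff.2 h) (norm_pos_iff.2 (hv φ hφ))).trans_le
    (ratio_le_ratioSup hΦ hΨ hv hφ hψ)

theorem continuousOn_ratioSup (hΦ : IsCompact Φ) (hΨ : IsCompact Ψ) :
    ContinuousOn (ratioSup Φ Ψ) {v | ∀ φ ∈ Φ, φ v ≠ 0} := by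
  have := isCompact_iff_compactSpace.1 hΦ
  have := isCompact_iff_compactSpace.1 hΨ
  rw [continuousOn_iff_continuous_domRestrict]
  have hc : Continuous (Function.uncurry
      (fun (v : {v : Fin (n + 1) → ℂ | ∀ φ ∈ Φ, φ v ≠ 0}) (p : Φ × Ψ) =>
        ‖p.2.1 v.1‖ / ‖p.1.1 v.1‖)) := by
    refine Continuous.div ?_ ?_ fun x => norm_ne_zero_iff.2 (x.1.2 _ x.2.1.2)
    · exact ((continuous_subtype_val.comp (continuous_snd.comp continuous_snd)).clm_apply
        (continuous_subtype_val.comp continuous_fst)).norm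
    · exact ((continuous_subtype_val.comp (continuous_fst.comp continuous_snd)).clm_apply
        (continuous_subtype_val.comp continuous_fst)).norm
  convert (isCompact_univ (X := Φ × Ψ)).continuous_sSup
    (f := fun (v : {v : Fin (n + 1) → ℂ | ∀ φ ∈ Φ, φ v ≠ 0}) (p : Φ × Ψ) =>
      ‖p.2.1 v.1‖ / ‖p.1.1 v.1‖) hc using 2 with v
  simp only [domRestrict_apply, ratioSup]
  congr 1
  ext r
  simp [and_assoc]

theorem continuousOn_log_ratioSup (hΦ : IsCompact Φ) (hΨ : IsCompact Ψ) (hΦn : Φ.Nonempty) :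
    ContinuousOn (fun v => Real.log (ratioSup Φ Ψ v))
      {v | (∀ φ ∈ Φ, φ v ≠ 0) ∧ ∃ ψ ∈ Ψ, ψ v ≠ 0} :=
  ((continuousOn_ratioSup hΦ hΨ).mono fun _ hv => hv.1).log
    fun _ hv => (ratioSup_pos hΦ hΨ hΦn hv.1 hv.2).ne'

/-- Continuity is checked on lifts, through the quotient map. Some `ψ` being nonzero at each point
keeps the supremum positive, hence the logarithm continuous. -/
theorem continuousOn_logRatio (hΦ : IsCompact Φ) (hΨ : IsCompact Ψ) (hΦn : Φ.Nonempty)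
    (hΩ : IsOpen Ω) (h1 : ∀ ω ∈ Ω, ∀ φ ∈ Φ, φ ω.rep ≠ 0)
    (h2 : ∀ ω ∈ Ω, ∃ ψ ∈ Ψ, ψ ω.rep ≠ 0) : ContinuousOn (logRatio Φ Ψ) Ω := by
  rw [isQuotientMap_mk.continuousOn_isOpen_iff hΩ]
  have h := (continuousOn_log_ratioSup hΦ hΨ hΦn).comp
    (continuous_subtype_val (p := fun v : Fin (n + 1) → ℂ => v ≠ 0)).continuousOn
    (s := (fun v => Projectivization.mk ℂ v.1 v.2) ⁻¹' Ω) (fun v hv => ?_)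
  · exact h.congr fun v _ => logRatio_mk v.2
  · refine ⟨fun φ hφ => ?_, ?_⟩
    · exact fun h0 => h1 _ hv φ hφ ((apply_rep_mk_eq_zero φ v.2).2 h0)
    · obtain ⟨ψ, hψ, h0⟩ := h2 _ hv
      exact ⟨ψ, hψ, fun h3 => h0 ((apply_rep_mk_eq_zero ψ v.2).2 h3)⟩

/-- A pair `(φ, ψ)` attaining the supremum at the centre `v` is kept fixed on the whole disc: `log
|ψ / φ|` satisfies the inequality, agrees with the supremum at `v`, and lies below it on the circle
away from the zeros of `ψ`. -/
theorem log_ratioSup_le_circleAverage (hΦ : IsCompact Φ) (hΨ : IsCompact Ψ)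
    (hΦn : Φ.Nonempty) {v w : Fin (n + 1) → ℂ}
    (h1 : ∀ ζ : ℂ, ‖ζ‖ ≤ 1 → ∀ φ ∈ Φ, φ (v + ζ • w) ≠ 0) (h2 : ∃ ψ ∈ Ψ, ψ v ≠ 0)
    (hint : CircleIntegrable (fun ζ : ℂ => Real.log (ratioSup Φ Ψ (v + ζ • w))) 0 1) :
    Real.log (ratioSup Φ Ψ v) ≤
      Real.circleAverage (fun ζ : ℂ => Real.log (ratioSup Φ Ψ (v + ζ • w))) 0 1 := by
  have hv : ∀ φ ∈ Φ, φ v ≠ 0 := by simpa using h1 0 (by simp)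
  have hpos := ratioSup_pos hΦ hΨ hΦn hv h2
  obtain ⟨φ, hφ, ψ, hψ, h⟩ :=
    exists_ratio_eq_ratioSup hΦ hΨ hΦn (h2.imp fun _ h => h.1) hv
  have hψv : ψ v ≠ 0 := by
    intro h0
    rw [← h, h0] at hpos
    simp at hpos
  obtain ⟨hφi, hφa⟩ := circleAverage_log_norm_affine (α := φ v) (β := φ w)
    fun ζ hζ => by simpa using h1 ζ hζ φ hφ
  -- The term `log |φ|`, equal to its own average, moves to the right-hand side; only `log |ψ|`
  -- remains to be estimated.
  rw [← h, Real.log_div (norm_ne_zero_iff.2 hψv) (norm_ne_zero_iff.2 (hv φ hφ)),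
    sub_le_iff_le_add, ← hφa, ← Real.circleAverage_add hint hφi]
  refine log_norm_le_circleAverage hψv (hint.add hφi) (β := ψ w) fun ζ hζ h0 => ?_
  have hζ' : ‖ζ‖ ≤ 1 := by simpa using (mem_sphere_zero_iff_norm.1 hζ).le
  have hφ0 : φ (v + ζ • w) ≠ 0 := h1 ζ hζ' φ hφ
  have hψ0 : ψ (v + ζ • w) ≠ 0 := by simpa using h0
  have hle := Real.log_le_log (div_pos (norm_pos_iff.2 hψ0) (norm_pos_iff.2 hφ0))
    (ratio_le_ratioSup hΦ hΨ (h1 ζ hζ') hφ hψ)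
  rw [Real.log_div (norm_ne_zero_iff.2 hψ0) (norm_ne_zero_iff.2 hφ0),
    sub_le_iff_le_add] at hle
  simpa using hle

theorem continuous_affineChart (i : Fin (n + 1)) : Continuous (affineChart (n := n) i) := by
  have h : Continuous fun z : Fin n → ℂ => (i.insertNth (1 : ℂ) z : Fin (n + 1) → ℂ) :=
    continuous_const.finInsertNth i continuous_id
  exact (isQuotientMap_mk (V := Fin (n + 1) → ℂ)).continuous.comp
    (h.subtype_mk fun z h0 => by simpa using congrFun h0 i)

theorem isPSHOn_logRatio (hΦ : IsCompact Φ) (hΨ : IsCompact Ψ) (hΦn : Φ.Nonempty)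
    (hΩ : IsOpen Ω) (h1 : ∀ ω ∈ Ω, ∀ φ ∈ Φ, φ ω.rep ≠ 0)
    (h2 : ∀ ω ∈ Ω, ∃ ψ ∈ Ψ, ψ ω.rep ≠ 0) : IsPSHOn (logRatio Φ Ψ) Ω := by
  intro i
  have hcont : ContinuousOn (fun z => logRatio Φ Ψ (affineChart i z))
      {z | affineChart i z ∈ Ω} :=
    (continuousOn_logRatio hΦ hΨ hΦn hΩ h1 h2).comp (continuous_affineChart i).continuousOn
      fun _ hz => hz
  refine ⟨hcont.upperSemicontinuousOn, fun a b hab => ?_⟩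
  have hint : CircleIntegrable (fun ζ : ℂ => logRatio Φ Ψ (affineChart i (a + ζ • b))) 0 1 := by
    refine ContinuousOn.circleIntegrable zero_le_one
      (hcont.comp (f := fun ζ : ℂ => a + ζ • b) (by fun_prop) fun ζ hζ => hab ζ ?_)
    simpa using (mem_sphere_zero_iff_norm.1 hζ).le
  refine ⟨hint, ?_⟩
  -- An affine disc in the chart lifts to an affine disc in `ℂ^{n+1}`; the inserted coordinate is
  -- constant, so its direction has entry 0.
  have hline : ∀ ζ : ℂ, (i.insertNth (1 : ℂ) (a + ζ • b) : Fin (n + 1) → ℂ) =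
      (i.insertNth (1 : ℂ) a : Fin (n + 1) → ℂ) +
        ζ • (i.insertNth (0 : ℂ) b : Fin (n + 1) → ℂ) := by
    intro ζ
    ext j
    refine Fin.succAboveCases i ?_ (fun k => ?_) j <;> simp
  have hval : ∀ ζ : ℂ, logRatio Φ Ψ (affineChart i (a + ζ • b)) =
      Real.log (ratioSup Φ Ψ ((i.insertNth (1 : ℂ) a : Fin (n + 1) → ℂ) +
        ζ • (i.insertNth (0 : ℂ) b : Fin (n + 1) → ℂ))) := by
    intro ζ
    rw [← hline]
    exact logRatio_mk _
  have h0 := hval 0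
  simp only [zero_smul, add_zero] at h0
  simp only [h0, hval] at hint ⊢
  refine log_ratioSup_le_circleAverage hΦ hΨ hΦn (fun ζ hζ φ hφ => ?_) ?_ hint
  · rw [← hline]
    exact fun h => h1 _ (hab ζ hζ) φ hφ ((apply_rep_mk_eq_zero φ _).2 h)
  · obtain ⟨ψ, hψ, h⟩ := h2 _ (hab 0 (by simp))
    refine ⟨ψ, hψ, fun h3 => h ((apply_rep_mk_eq_zero ψ _).2 ?_)⟩
    simpa using h3

/-- Multiplying out the quotient bound gives a condition that makes sense on all of projective
space, including zeros of `φ`, and is invariant under rescaling the lift. -/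
theorem isClosed_norm_le (C : ℝ) :
    IsClosed {ω : CP n | ∀ φ ∈ Φ, ∀ ψ ∈ Ψ, ‖ψ ω.rep‖ ≤ C * ‖φ ω.rep‖} := by
  rw [← isQuotientMap_mk.isClosed_preimage]
  have : (fun v : {v : Fin (n + 1) → ℂ // v ≠ 0} => Projectivization.mk ℂ v.1 v.2) ⁻¹'
      {ω : CP n | ∀ φ ∈ Φ, ∀ ψ ∈ Ψ, ‖ψ ω.rep‖ ≤ C * ‖φ ω.rep‖} =
      {v | ∀ φ ∈ Φ, ∀ ψ ∈ Ψ, ‖ψ v.1‖ ≤ C * ‖φ v.1‖} := by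
    ext v
    obtain ⟨a, ha⟩ := Projectivization.exists_smul_eq_mk_rep ℂ v.1 v.2
    have h0 : 0 < ‖(a : ℂ)‖ := norm_pos_iff.2 a.ne_zero
    simp only [mem_preimage, mem_ofPred_eq, ← ha, Units.smul_def, map_smul, smul_eq_mul,
      norm_mul, mul_left_comm C, mul_le_mul_iff_of_pos_left h0]
  rw [this]
  simp only [ofPred_forall]
  refine isClosed_iInter fun φ => isClosed_iInter fun _ => isClosed_iInter fun ψ =>
    isClosed_iInter fun _ => isClosed_le ?_ ?_
  · exact (ψ.continuous.comp continuous_subtype_val).norm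
  · exact continuous_const.mul (φ.continuous.comp continuous_subtype_val).norm

theorem isExhaustionOn_logRatio (hΦ : IsCompact Φ) (hΨ : IsCompact Ψ) (hΦn : Φ.Nonempty)
    (hΩ : IsOpen Ω) (h1 : ∀ ω, ω ∈ Ω ↔ ∀ φ ∈ Φ, φ ω.rep ≠ 0)
    (h2 : ∀ ω : CP n, ∃ ψ ∈ Ψ, ψ ω.rep ≠ 0) : IsExhaustionOn (logRatio Φ Ψ) Ω := by
  refine ⟨continuousOn_logRatio hΦ hΨ hΦn hΩ (fun ω hω => (h1 ω).1 hω) fun ω _ => h2 ω,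
    fun c => ?_⟩
  have := compactSpace_projectivization (V := Fin (n + 1) → ℂ)
  -- This compact set lies in `Ω`: at a zero of some `φ` the bound would make every `ψ` vanish.
  refine ⟨_, (isClosed_norm_le (Φ := Φ) (Ψ := Ψ) (Real.exp c)).isCompact, ?_, ?_⟩
  · intro ω hω
    rw [h1]
    intro φ hφ h0
    obtain ⟨ψ, hψ, h⟩ := h2 ω
    have := hω φ hφ ψ hψ
    rw [h0, norm_zero, mul_zero] at this
    exact h (norm_le_zero_iff.1 this)
  · rintro ω ⟨hω, hc⟩ φ hφ ψ hψ
    rw [h1] at hω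
    rw [← div_le_iff₀ (norm_pos_iff.2 (hω φ hφ))]
    exact (ratio_le_ratioSup hΦ hΨ hω hφ hψ).trans
      ((Real.log_lt_iff_lt_exp (ratioSup_pos hΦ hΨ hΦn hω (h2 ω))).1 hc).le

end RatioSup

/-! ### Lifts of `Λ` and the Hilbert pseudo-metric. -/

section Forms

variable {n : ℕ} {Λ : Set (CPDual n)}

theorem forall_unitLifts_iff (ω : CP n) :
    (∀ φ ∈ unitLifts Λ, φ ω.rep ≠ 0) ↔ ∀ φ ∈ Λ, ¬ Vanishes φ ω := by
  constructor
  · intro h φ hφ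
    obtain ⟨f, hf1, hf0, rfl⟩ := exists_unitLift φ
    rw [← ω.mk_rep, vanishes_mk]
    exact h f ⟨hf1, hf0, hφ⟩
  · rintro h f ⟨-, hf0, hf⟩
    rw [Ne, ← vanishes_mk f hf0 ω.rep ω.rep_nonzero, ω.mk_rep]
    exact h _ hf

/-- The lifts of the forms in `Λ` that take the value `1` at the chosen lift of `ω₀`. -/
noncomputable def normalizedLifts (Λ : Set (CPDual n)) (ω₀ : CP n) :
    Set ((Fin (n + 1) → ℂ) →L[ℂ] ℂ) :=
  (fun φ : CPDual n => (φ.rep ω₀.rep)⁻¹ • φ.rep) '' Λ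

/-- The representative `φ.rep` need not depend continuously on `φ`, but `f / f(ω₀)` does not depend
on the lift `f`, so unit lifts may be used instead; these form a compact set. -/
theorem isCompact_normalizedLifts (hΛ : IsClosed Λ) {ω₀ : CP n}
    (h : ∀ φ ∈ Λ, ¬ Vanishes φ ω₀) : IsCompact (normalizedLifts Λ ω₀) := by
  have h0 := (forall_unitLifts_iff ω₀).2 h
  have hc : ContinuousOn (fun f : (Fin (n + 1) → ℂ) →L[ℂ] ℂ => (f ω₀.rep)⁻¹ • f)
      (unitLifts Λ) :=
    ContinuousOn.smul (ContinuousOn.inv₀ (by fun_prop) h0) continuousOn_id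
  have hr : ∀ (f : (Fin (n + 1) → ℂ) →L[ℂ] ℂ) (hf : f ≠ 0),
      ((Projectivization.mk ℂ f hf).rep ω₀.rep)⁻¹ • (Projectivization.mk ℂ f hf).rep =
        (f ω₀.rep)⁻¹ • f := by
    intro f hf
    obtain ⟨a, ha⟩ := Projectivization.exists_smul_eq_mk_rep ℂ f hf
    rw [← ha]
    simp only [Units.smul_def, FunLike.coe_smul, Pi.smul_apply, smul_eq_mul, mul_inv, smul_smul]
    congr 1
    field_simp [a.ne_zero]
  convert (isCompact_unitLifts hΛ).image_of_continuousOn hc using 1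
  ext g
  constructor
  · rintro ⟨φ, hφ, rfl⟩
    obtain ⟨f, hf1, hf0, rfl⟩ := exists_unitLift φ
    exact ⟨f, ⟨hf1, hf0, hφ⟩, (hr f hf0).symm⟩
  · rintro ⟨f, ⟨-, hf0, hf⟩, rfl⟩
    exact ⟨_, hf, hr f hf0⟩

theorem normalizedLift_apply_ne_zero_iff {φ : CPDual n} {ω₀ : CP n} (h : ¬ Vanishes φ ω₀)
    (ω : CP n) : ((φ.rep ω₀.rep)⁻¹ • φ.rep) ω.rep ≠ 0 ↔ ¬ Vanishes φ ω := by
  unfold Vanishes at *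
  simp [h]

theorem hilbertDist_eq_logRatio (Λ : Set (CPDual n)) (ω₀ ω : CP n) :
    hilbertDist Λ ω₀ ω = logRatio (normalizedLifts Λ ω₀) (normalizedLifts Λ ω₀) ω := by
  have key : ∀ φ φ' : CPDual n, ‖crossRatio φ φ' ω₀ ω‖ =
      ‖((φ'.rep ω₀.rep)⁻¹ • φ'.rep) ω.rep‖ / ‖((φ.rep ω₀.rep)⁻¹ • φ.rep) ω.rep‖ := by
    -- With `0⁻¹ = 0`, the rearrangement holds even where a form vanishes.
    intro φ φ'
    rw [← norm_div, crossRatio]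
    simp only [FunLike.coe_smul, Pi.smul_apply, smul_eq_mul, div_eq_mul_inv, mul_inv, inv_inv]
    congr 1
    ring
  unfold hilbertDist logRatio ratioSup normalizedLifts
  congr 2
  ext r
  constructor
  · rintro ⟨φ, hφ, φ', hφ', rfl⟩
    exact ⟨(_, _), ⟨⟨φ, hφ, rfl⟩, φ', hφ', rfl⟩, (key φ φ').symm⟩
  · rintro ⟨⟨_, _⟩, ⟨⟨φ, hφ, rfl⟩, φ', hφ', rfl⟩, rfl⟩
    exact ⟨φ, hφ, φ', hφ', (key φ φ').symm⟩

end Forms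

end ComplexHilbert

theorem mainTheorem10 (n : ℕ) (hn : 1 ≤ n)
    (Ω : Set (ComplexHilbert.CP n)) (Λ : Set (ComplexHilbert.CPDual n))
    (hadm : ComplexHilbert.IsAdmissible Ω Λ) (hsat : ComplexHilbert.IsSaturated Ω Λ) :
    ComplexHilbert.IsPseudoconvex Ω ∧
      ∀ ω₀ ∈ Ω,
        ComplexHilbert.IsPSHOn (fun ω => ComplexHilbert.hilbertDist Λ ω₀ ω) Ω ∧
        ((∀ p : ComplexHilbert.CP n, ∃ φ ∈ Λ, ¬ ComplexHilbert.Vanishes φ p) →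
          ComplexHilbert.IsExhaustionOn (fun ω => ComplexHilbert.hilbertDist Λ ω₀ ω) Ω) := by
  open ComplexHilbert in
  have hmem : ∀ ω, ω ∈ Ω ↔ ∀ φ ∈ Λ, ¬ Vanishes φ ω := fun ω => by
    conv_lhs => rw [hsat]
    rfl
  constructor
  · have hΦ := isCompact_unitLifts hadm.isClosed
    have hΦn : (unitLifts Λ).Nonempty := by
      obtain ⟨φ, hφ⟩ := hadm.nonempty_right
      obtain ⟨f, hf1, hf0, rfl⟩ := exists_unitLift φ
      exact ⟨f, hf1, hf0, hφ⟩
    -- The coordinate forms are finitely many and have no common zero in projective space.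
    have hΨ : IsCompact (Set.range fun i : Fin (n + 1) =>
        (ContinuousLinearMap.proj i : (Fin (n + 1) → ℂ) →L[ℂ] ℂ)) :=
      (Set.finite_range _).isCompact
    have h1 : ∀ ω, ω ∈ Ω ↔ ∀ φ ∈ unitLifts Λ, φ ω.rep ≠ 0 := fun ω =>
      (hmem ω).trans (forall_unitLifts_iff ω).symm
    have h2 : ∀ ω : CP n, ∃ ψ ∈ Set.range fun i : Fin (n + 1) =>
        (ContinuousLinearMap.proj i : (Fin (n + 1) → ℂ) →L[ℂ] ℂ), ψ ω.rep ≠ 0 := fun ω => by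
      obtain ⟨i, hi⟩ := Function.ne_iff.1 ω.rep_nonzero
      exact ⟨_, ⟨i, rfl⟩, hi⟩
    exact ⟨hadm.isOpen, _,
      isPSHOn_logRatio hΦ hΨ hΦn hadm.isOpen (fun ω hω => (h1 ω).1 hω) fun ω _ => h2 ω,
      isExhaustionOn_logRatio hΦ hΨ hΦn hadm.isOpen h1 h2⟩
  · intro ω₀ hω₀
    have hv := (hmem ω₀).1 hω₀
    have hΦ := isCompact_normalizedLifts hadm.isClosed hv
    have hΦn : (normalizedLifts Λ ω₀).Nonempty := hadm.nonempty_right.image _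
    have h1 : ∀ ω, ω ∈ Ω ↔ ∀ φ ∈ normalizedLifts Λ ω₀, φ ω.rep ≠ 0 := fun ω => by
      rw [hmem, normalizedLifts, Set.forall_mem_image]
      exact forall₂_congr fun φ hφ => (normalizedLift_apply_ne_zero_iff (hv φ hφ) ω).symm
    simp only [hilbertDist_eq_logRatio]
    refine ⟨isPSHOn_logRatio hΦ hΦ hΦn hadm.isOpen (fun ω hω => (h1 ω).1 hω) fun ω hω => ?_,
      fun hspan => isExhaustionOn_logRatio hΦ hΦ hΦn hadm.isOpen h1 fun ω => ?_⟩
    -- On `Ω` no form of `Λ` vanishes, so any one serves as a nonzero numerator; the spanning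
    -- hypothesis is needed only off `Ω`.
    · obtain ⟨φ, hφ⟩ := hΦn
      exact ⟨φ, hφ, (h1 ω).1 hω φ hφ⟩
    · obtain ⟨φ, hφ, h⟩ := hspan ω
      exact ⟨_, ⟨φ, hφ, rfl⟩, (normalizedLift_apply_ne_zero_iff (hv φ hφ) ω).2 h⟩
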